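/- Let $n\ge 3$ and let $(W,S)$ be a Coxeter system of type $D_n$, with $S=\{s_1,\dots,s_n\}$ labelled so that the edges of the Coxeter graph are $s_1 - s_3$ and $s_a - s_{a+1}$ for $2\le a<n$, all with label $3$; then $W$ is finite. Let $\ell$ be the length function of $W$ with respect to $S$. For $J\subseteq S$ put $X_J=\{w\in W:\ell(ws)>\ell(w)\text{ for all }s\in J\}$ and $x_J=\sum_{w\in X_J}w$ in the group algebra $\mathbb{Q}W$. Put $x_j=x_{\{s_1,\dots,s_j\}}$ for $2\le j\le n$, $x_1=x_\emptyset$ and, by convention, $x_0=2x_1$. Let $\mathfrak{E}(W)=\mathbb{Q}[x_{n-1}]$ be the smallest $\mathbb{Q}$-subalgebra of $\mathbb{Q}W$ containing $x_{n-1}$. Write $x^{\underline{k}}=\prod_{i=0}^{k-1}(x-i)$, and let $\genfrac{[}{]}{0pt}{}{k}{m}$ and $\genfrac{\{}{\}}{0pt}{}{k}{m}$ be the (unsigned) Stirling numbers of the first kind and the Stirling numbers of the second kind. Then there is an isomorphism of $\mathbb{Q}$-algebras $$\mathfrak{E}(W)\;\cong\;\mathbb{Q}[x]/(x^{\underline{n}}-x^{\underline{n-1}})$$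 which sends $x_{n-1}$ to the coset of $2x$. Both $\{x_1,\dots,x_n\}$ and $\{x_{n-1}^0,\dots,x_{n-1}^{n-1}\}$ are $\mathbb{Q}$-bases of $\mathfrak{E}(W)$ with $n$ elements. For $0\le k\le n-1$ we have $$x_{n-k}=\prod_{i=0}^{k-1}(x_{n-1}-2i),$$ and the two bases are related by the base change formulas $$x_{n-k}=\sum_{m=0}^{k}(-2)^{k-m}\genfrac{[}{]}{0pt}{}{k}{m}\,x_{n-1}^m,\qquad x_{n-1}^k=\sum_{m=0}^{k}\genfrac{\{}{\}}{0pt}{}{k}{m}\,2^{k-m}\,x_{n-m}.$$ -/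

import Mathlib

open Polynomial

noncomputable section

/-- The Coxeter matrix of type `D_n`. The index `i : Fin n` stands for the generator `s_{i+1}`.
In the Coxeter graph, `s_1` and `s_2` are the two ends of the fork: the edges are `s_1 — s_3`
and `s_a — s_{a+1}` for `2 ≤ a < n`, all of them with label `3`. -/
def typeD (n : ℕ) : CoxeterMatrix (Fin n) where
  M := Matrix.of fun i j : Fin n =>
    if i = j then 1
    else if ((i : ℕ) = 0 ∧ (j : ℕ) = 2) ∨ ((j : ℕ) = 0 ∧ (i : ℕ) = 2) ∨
        (1 ≤ (i : ℕ) ∧ (j : ℕ) = i + 1) ∨ (1 ≤ (j : ℕ) ∧ (i : ℕ) = j + 1) then 3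
    else 2
  isSymm := by
    ext i j
    simp only [Matrix.transpose_apply, Matrix.of_apply]
    split_ifs <;> first | rfl | (exfalso; simp_all; done) | (exfalso; omega)
  diagonal := by simp
  off_diagonal := by
    intro i j h
    simp only [Matrix.of_apply, if_neg h]
    split_ifs <;> decide

section DescentAlgebra

variable {B W : Type*} [Group W] {M : CoxeterMatrix B}

/-- The set `X_J` of all `w ∈ W` with `ℓ(ws) > ℓ(w)` for all `s ∈ J`: the distinguished
representatives of the left cosets of `W_J` in `W`. -/
def distinguishedReps (cs : CoxeterSystem M W) (J : Set B) : Set W :=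
  {w | ∀ i ∈ J, cs.length w < cs.length (w * cs.simple i)}

/-- The element `x_J = ∑_{w ∈ X_J} w` of the group algebra `ℚW`, for a finite Coxeter group `W`. -/
def descentElt (cs : CoxeterSystem M W) (J : Set B) : MonoidAlgebra ℚ W :=
  ∑ᶠ w ∈ distinguishedReps cs J, MonoidAlgebra.of ℚ W w

end DescentAlgebra

section TypeD

variable {n : ℕ} {W : Type*} [Group W]

/-- The elements `x_j` in type `D_n`: `x_j = x_{{s_1, …, s_j}}` for `2 ≤ j ≤ n`, while
`x_1 = x_∅` (the set `{s_1}` is not used) and `x_0 = 2 x_1`. -/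
def xD (cs : CoxeterSystem (typeD n) W) : ℕ → MonoidAlgebra ℚ W
  | 0 => 2 * descentElt cs ∅
  | 1 => descentElt cs ∅
  | j + 2 => descentElt cs {i : Fin n | (i : ℕ) < j + 2}

/-- `𝔈(W) = ℚ[x_{n-1}]`, the smallest subalgebra of the group algebra containing `x_{n-1}`. -/
def algE (cs : CoxeterSystem (typeD n) W) : Subalgebra ℚ (MonoidAlgebra ℚ W) :=
  Algebra.adjoin ℚ {xD cs (n - 1)}

/-- `x_{n-1}` as an element of `𝔈(W)`. -/
def algEGen (cs : CoxeterSystem (typeD n) W) : algE cs :=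
  ⟨xD cs (n - 1), Algebra.self_mem_adjoin_singleton ℚ _⟩

end TypeD

end

/-! Everything follows from the rule `xD_mul_xD_pred`: x_j x_{n-1} = 2(n-j) x_j + x_{j-1} for 1 ≤ j
≤ n. Since x_n = 1, iterating it gives x_{n-k} = ∏_{i<k} (x_{n-1} - 2i) for all k ≤ n. At k = n the
convention x_0 = 2x_1 becomes the polynomial relation satisfied by x_{n-1}. Substituting x_{n-1} =
2x turns it into x^{\underline n} = x^{\underline{n-1}}, and linear independence of x_1, …, x_n
shows that there is no further relation.

To prove the rule, W acts on signed words ("windows"). Right ascents are read off the window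
(`length_lt_mul_simple_iff`), so the action is faithful and X_j consists of the w whose window
satisfies |g 0| < g 1 < ⋯ < g (j-1). The element x_{n-1} is a sum of 2n elements, which flip or keep
the signs of the two end entries and then move the last entry to a position c. The coefficient of w
in x_j x_{n-1} thus counts the pairs (c, sign) making the first j entries increasing
(`sum_inc_insertAt`). Positions c ≥ j do not affect the condition; among c < j exactly one pair
works if the first j-1 entries were already increasing, and none otherwise. -/

noncomputable section

/-! ### Signed permutations and simple roots -/

/-- The action of the generator with index `i` on the window of a signed permutation. -/
def reflAct (i : ℕ) (g : ℕ → ℤ) (k : ℕ) : ℤ :=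
  if i = 0 then (if k = 0 then -g 1 else if k = 1 then -g 0 else g k)
  else if k + 1 = i then g i else if k = i then g (i - 1) else g k

/-- The value of the simple root with index `i` on the window of a signed permutation. -/
def rootVal (g : ℕ → ℤ) (i : ℕ) : ℤ :=
  if i = 0 then g 0 + g 1 else g i - g (i - 1)

/-- Adjacency in the Coxeter graph of type `D`. -/
def adjD (i j : ℕ) : Prop :=
  (i = 0 ∧ j = 2) ∨ (j = 0 ∧ i = 2) ∨ (1 ≤ i ∧ j = i + 1) ∨ (1 ≤ j ∧ i = j + 1)

theorem typeD_cases {n : ℕ} (i j : Fin n) :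
    (i = j ∧ typeD n i j = 1) ∨ (i ≠ j ∧ adjD i j ∧ typeD n i j = 3) ∨
      (i ≠ j ∧ ¬ adjD i j ∧ typeD n i j = 2) := by
  by_cases h : i = j
  · exact Or.inl ⟨h, by subst h; exact (typeD n).diagonal i⟩
  · by_cases h' : adjD i j
    · exact Or.inr (Or.inl ⟨h, h', (if_neg h).trans (if_pos h')⟩)
    · exact Or.inr (Or.inr ⟨h, h', (if_neg h).trans (if_neg h')⟩)

theorem reflAct_reflAct (i : ℕ) (g : ℕ → ℤ) : reflAct i (reflAct i g) = g := by
  funext k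
  unfold reflAct
  grind

theorem reflAct_comm {i j : ℕ} (hij : i ≠ j) (h : ¬ adjD i j) (g : ℕ → ℤ) :
    reflAct i (reflAct j g) = reflAct j (reflAct i g) := by
  funext k
  unfold adjD at h
  unfold reflAct
  grind

theorem reflAct_braid {i j : ℕ} (h : adjD i j) (g : ℕ → ℤ) :
    reflAct i (reflAct j (reflAct i g)) = reflAct j (reflAct i (reflAct j g)) := by
  funext k
  unfold adjD at h
  unfold reflAct
  grind

theorem rootVal_reflAct_self (i : ℕ) (g : ℕ → ℤ) :
    rootVal (reflAct i g) i = -rootVal g i := by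
  unfold rootVal reflAct
  grind

theorem rootVal_reflAct_comm {i j : ℕ} (hij : i ≠ j) (h : ¬ adjD i j) (g : ℕ → ℤ) :
    rootVal (reflAct j g) i = rootVal g i := by
  unfold adjD at h
  unfold rootVal reflAct
  grind

theorem rootVal_reflAct_adj {i j : ℕ} (h : adjD i j) (g : ℕ → ℤ) :
    rootVal (reflAct j g) i = rootVal g i + rootVal g j := by
  rcases h with ⟨rfl, rfl⟩ | ⟨rfl, rfl⟩ | ⟨h, rfl⟩ | ⟨h, rfl⟩
  all_goals
    unfold rootVal reflAct
    grind

theorem adjD_symm {i j : ℕ} (h : adjD i j) : adjD j i := by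
  unfold adjD at *
  omega

/-- The window of the identity. -/
def idWindow (k : ℕ) : ℤ := k

/-- The vector (0, 1, 2, …) plays the role of ρ: every simple root takes the value 1 on it. -/
theorem rootVal_idWindow_pos (i : ℕ) : 0 < rootVal idWindow i := by
  unfold rootVal idWindow
  grind

/-- `reflAct` as an element of the monoid of self-maps. -/
def reflEnd (i : ℕ) : Function.End (ℕ → ℤ) := reflAct i

/-- The properties of the windows of signed permutations of `{0, …, n - 1}`. -/
structure IsWindow (n : ℕ) (g : ℕ → ℤ) : Prop where
  abs_inj : ∀ a b, |g a| = |g b| → a = b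
  abs_lt : ∀ k < n, |g k| < n
  apply_of_le : ∀ k, n ≤ k → g k = k

theorem isWindow_idWindow (n : ℕ) : IsWindow n idWindow where
  abs_inj a b h := by simpa [idWindow] using h
  abs_lt k h := by simpa [idWindow] using h
  apply_of_le _ _ := rfl

theorem exists_abs_reflAct (i : ℕ) :
    ∃ p : ℕ → ℕ, Function.Injective p ∧ ∀ (g : ℕ → ℤ) (k : ℕ), |reflAct i g k| = |g (p k)| := by
  refine ⟨if i = 0 then Equiv.swap 0 1 else Equiv.swap (i - 1) i, ?_, fun g k => ?_⟩
  · split_ifs <;> exact Equiv.injective _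
  · unfold reflAct
    grind [abs_neg]

theorem IsWindow.reflAct {n : ℕ} {g : ℕ → ℤ} (h : IsWindow n g) (hn : 2 ≤ n) {i : ℕ}
    (hi : i < n) : IsWindow n (reflAct i g) where
  abs_inj a b hab := by
    obtain ⟨p, hp, hg⟩ := exists_abs_reflAct i
    rw [hg, hg] at hab
    exact hp (h.abs_inj _ _ hab)
  abs_lt k hk := by
    have := h.abs_lt
    unfold _root_.reflAct
    grind
  apply_of_le k hk := by
    have := h.apply_of_le k hk
    unfold _root_.reflAct
    grind

/-! ### The action of W on windows; descents and faithfulness -/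

section Window

variable {n : ℕ} {W : Type*} [Group W] (cs : CoxeterSystem (typeD n) W)

theorem isLiftable_reflEnd (n : ℕ) :
    (typeD n).IsLiftable (fun i : Fin n => reflEnd i) := by
  intro i j
  rcases typeD_cases i j with ⟨rfl, h⟩ | ⟨-, h', h⟩ | ⟨hij, h', h⟩ <;> rw [h]
  · funext g
    exact reflAct_reflAct i g
  · funext g
    change reflAct i (reflAct j (reflAct i (reflAct j (reflAct i (reflAct j g))))) = g
    rw [reflAct_braid h', reflAct_reflAct, reflAct_reflAct, reflAct_reflAct]
  · funext g
    change reflAct i (reflAct j (reflAct i (reflAct j g))) = g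
    rw [reflAct_comm (Fin.val_ne_of_ne hij) h', reflAct_reflAct, reflAct_reflAct]

/-- The action of `W` on windows. -/
def windowAct : W →* Function.End (ℕ → ℤ) := cs.lift ⟨_, isLiftable_reflEnd n⟩

theorem windowAct_simple (i : Fin n) (g : ℕ → ℤ) :
    windowAct cs (cs.simple i) g = reflAct i g :=
  congrFun (cs.lift_apply_simple (isLiftable_reflEnd n) i) g

theorem windowAct_mul (v w : W) (g : ℕ → ℤ) :
    windowAct cs (v * w) g = windowAct cs v (windowAct cs w g) := by
  rw [map_mul]; rfl

theorem windowAct_one (g : ℕ → ℤ) : windowAct cs 1 g = g := by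
  rw [map_one]; rfl

/-- The window of an element of `W`. -/
def window (w : W) : ℕ → ℤ := windowAct cs w⁻¹ idWindow

theorem window_one : window cs 1 = idWindow := by
  rw [window, inv_one, windowAct_one]

theorem window_mul (v w : W) : window cs (v * w) = windowAct cs w⁻¹ (window cs v) := by
  rw [window, mul_inv_rev, windowAct_mul, window]

theorem window_mul_simple (w : W) (i : Fin n) :
    window cs (w * cs.simple i) = reflAct i (window cs w) := by
  rw [window_mul, cs.inv_simple, windowAct_simple]

theorem simple_comm {i j : Fin n} (hij : i ≠ j) (h : ¬ adjD i j) :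
    cs.simple i * cs.simple j = cs.simple j * cs.simple i := by
  have h2 : typeD n i j = 2 := by
    rcases typeD_cases i j with h' | h' | h'
    exacts [absurd h'.1 hij, absurd h'.2.1 h, h'.2.2]
  have := cs.simple_mul_simple_pow i j
  rw [h2, pow_two, mul_eq_one_iff_eq_inv, mul_inv_rev, cs.inv_simple, cs.inv_simple] at this
  exact this

theorem simple_braid {i j : Fin n} (hij : i ≠ j) (h : adjD i j) :
    cs.simple i * cs.simple j * cs.simple i = cs.simple j * cs.simple i * cs.simple j := by
  have h2 : typeD n i j = 3 := by
    rcases typeD_cases i j with h' | h' | h'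
    exacts [absurd h'.1 hij, h'.2.2, absurd h h'.2.1]
  have := cs.simple_mul_simple_pow i j
  rw [h2, pow_succ, pow_two,
    show cs.simple i * cs.simple j * (cs.simple i * cs.simple j) * (cs.simple i * cs.simple j) =
      (cs.simple i * cs.simple j * cs.simple i) * (cs.simple j * cs.simple i * cs.simple j) by
        group, mul_eq_one_iff_eq_inv] at this
  simpa [mul_assoc] using this

theorem length_mul_le_add_one (w : W) (i : Fin n) :
    cs.length (w * cs.simple i) ≤ cs.length w + 1 := by
  simpa using cs.length_mul_le w (cs.simple i)

/-- Rank-two reduction: strip a right descent j from w and express the root value at i through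
values at shorter elements, using how s_j changes the root i. -/
theorem rootVal_window_pos (w : W) (i : Fin n) (h : cs.length w < cs.length (w * cs.simple i)) :
    0 < rootVal (window cs w) i := by
  induction hl : cs.length w using Nat.strong_induction_on generalizing w i with
  | _ l ih =>
  subst hl
  by_cases hw : w = 1
  · subst hw
    rw [window_one]
    exact rootVal_idWindow_pos i
  obtain ⟨j, hj⟩ := cs.exists_rightDescent_of_ne_one hw
  unfold CoxeterSystem.IsRightDescent at hj
  obtain ⟨v, rfl⟩ : ∃ v, w = v * cs.simple j :=
    ⟨w * cs.simple j, (cs.simple_mul_simple_cancel_right j).symm⟩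
  rw [cs.simple_mul_simple_cancel_right] at hj
  have hij : i ≠ j := by
    rintro rfl
    rw [cs.simple_mul_simple_cancel_right] at h
    omega
  rw [window_mul_simple]
  by_cases hadj : adjD i j
  · rw [rootVal_reflAct_adj hadj]
    have hpj := ih _ hj v j hj rfl
    rcases (cs.length_mul_simple v i) with hv | hv
    · have hpi := ih _ hj v i (by omega) rfl
      omega
    · obtain ⟨u, rfl⟩ : ∃ u, v = u * cs.simple i :=
        ⟨v * cs.simple i, (cs.simple_mul_simple_cancel_right i).symm⟩
      rw [cs.simple_mul_simple_cancel_right] at hv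
      -- With w = u s_i s_j, the two contributions of the root i cancel and only the value of the
      -- root j at u remains.
      rw [window_mul_simple, rootVal_reflAct_self, rootVal_reflAct_adj (adjD_symm hadj)]
      have hu : cs.length u < cs.length (u * cs.simple j) := by
        rcases cs.length_mul_simple u j with hu | hu
        · omega
        · exfalso
          obtain ⟨z, rfl⟩ : ∃ z, u = z * cs.simple j :=
            ⟨u * cs.simple j, (cs.simple_mul_simple_cancel_right j).symm⟩
          rw [cs.simple_mul_simple_cancel_right] at hu
          -- If j were a descent of u, the braid relation would write w s_i with only two letters
          -- after z, although w has length ℓ(z) + 3.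
          have e : z * cs.simple j * cs.simple i * cs.simple j * cs.simple i =
              z * cs.simple i * cs.simple j := by
            have := simple_braid cs hij.symm (adjD_symm hadj)
            calc _ = z * (cs.simple j * cs.simple i * cs.simple j) * cs.simple i := by group
              _ = z * cs.simple i * cs.simple j * cs.simple i * cs.simple i := by
                rw [this]; group
              _ = _ := cs.simple_mul_simple_cancel_right i
          rw [e] at h
          have h1 := length_mul_le_add_one cs (z * cs.simple i) j
          have h2 := length_mul_le_add_one cs z i
          omega
      have := ih _ (by omega) u j hu rfl
      omega
  · rw [rootVal_reflAct_comm (Fin.val_ne_of_ne hij) hadj]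
    refine ih _ hj v i ?_ rfl
    rcases cs.length_mul_simple v i with hv | hv
    · omega
    · exfalso
      rw [mul_assoc, ← simple_comm cs hij hadj, ← mul_assoc] at h
      have := length_mul_le_add_one cs (v * cs.simple i) j
      omega

/-- Right ascents can be read off the window. -/
theorem length_lt_mul_simple_iff (w : W) (i : Fin n) :
    cs.length w < cs.length (w * cs.simple i) ↔ 0 < rootVal (window cs w) i := by
  refine ⟨rootVal_window_pos cs w i, fun h => ?_⟩
  rcases cs.length_mul_simple w i with hl | hl
  · omega
  · have := rootVal_window_pos cs (w * cs.simple i) i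
      (by rw [cs.simple_mul_simple_cancel_right]; omega)
    rw [window_mul_simple, rootVal_reflAct_self] at this
    omega

theorem eq_one_of_rootVal_pos {w : W} (h : ∀ i : Fin n, 0 < rootVal (window cs w) i) :
    w = 1 := by
  by_contra hw
  obtain ⟨i, hi⟩ := cs.exists_rightDescent_of_ne_one hw
  have := (length_lt_mul_simple_iff cs w i).2 (h i)
  unfold CoxeterSystem.IsRightDescent at hi
  omega

/-- Equal windows give v w⁻¹ the window of the identity, so it has no right descent. -/
theorem window_injective : Function.Injective (window cs) := by
  intro v w h
  have : v * w⁻¹ = 1 := by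
    apply eq_one_of_rootVal_pos cs
    intro i
    rw [window_mul, h, ← window_mul, mul_inv_cancel, window_one]
    exact rootVal_idWindow_pos i
  rwa [mul_inv_eq_one] at this

theorem isWindow_window (hn : 2 ≤ n) (w : W) : IsWindow n (window cs w) := by
  induction w using cs.simple_induction_right with
  | one => exact window_one cs ▸ isWindow_idWindow n
  | mul_simple_right w i ih => exact window_mul_simple cs w i ▸ ih.reflAct hn i.isLt

theorem finite_of_typeD {n : ℕ} {W : Type*} [Group W] (cs : CoxeterSystem (typeD n) W)
    (hn : 2 ≤ n) : Finite W := by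
  let f : W → Fin n → Set.Icc (-n : ℤ) n := fun w k =>
    ⟨window cs w k, by
      have := abs_lt.1 ((isWindow_window cs hn w).abs_lt k k.isLt)
      exact ⟨this.1.le, this.2.le⟩⟩
  refine Finite.of_injective f fun v w h => window_injective cs (funext fun k => ?_)
  by_cases hk : k < n
  · exact congrArg Subtype.val (congrFun h ⟨k, hk⟩)
  · rw [(isWindow_window cs hn v).apply_of_le k (by omega),
      (isWindow_window cs hn w).apply_of_le k (by omega)]

/-! ### Distinguished representatives as increasing windows -/

/-- The first `j` entries of the window are increasing, the first one up to sign. -/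
def Inc (j : ℕ) (g : ℕ → ℤ) : Prop := ∀ a b, a < b → b < j → |g a| < g b

theorem inc_iff_rootVal {j : ℕ} (hj : 2 ≤ j) (g : ℕ → ℤ) :
    Inc j g ↔ ∀ i < j, 0 < rootVal g i := by
  constructor
  · intro h i hi
    unfold rootVal
    split_ifs with h0
    · have := h 0 1 (by omega) (by omega)
      have := neg_abs_le (g 0)
      omega
    · have := h (i - 1) i (by omega) hi
      have := le_abs_self (g (i - 1))
      omega
  · intro h a b hab
    have h0 : 0 < g 0 + g 1 := h 0 (by omega)
    have hs : ∀ c, c + 1 < j → g c < g (c + 1) := by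
      intro c hc
      have := h (c + 1) hc
      rw [rootVal, if_neg (by omega), Nat.add_sub_cancel] at this
      omega
    have hpos : ∀ c, c + 1 < j → 0 < g (c + 1) := by
      intro c
      induction c with
      | zero =>
        intro hc
        have := hs 0 hc
        rw [Nat.zero_add] at *
        omega
      | succ c ih =>
        intro hc
        have := hs (c + 1) hc
        have := ih (by omega)
        omega
    induction b, hab using Nat.le_induction with
    | base =>
      intro hb
      refine abs_lt.2 ⟨?_, hs a hb⟩
      rcases a with _ | a
      · rw [Nat.succ_eq_add_one, Nat.zero_add]
        omega
      · have := hpos a (by omega)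
        have := hpos (a + 1) hb
        rw [Nat.succ_eq_add_one]
        omega
    | succ b hab ih =>
      intro hb
      exact (ih (by omega)).trans (hs b hb)

theorem mem_distinguishedReps_iff {j : ℕ} (hj : 2 ≤ j) (hjn : j ≤ n) (w : W) :
    w ∈ distinguishedReps cs {i : Fin n | (i : ℕ) < j} ↔ Inc j (window cs w) := by
  rw [inc_iff_rootVal hj]
  simp only [distinguishedReps, Set.mem_ofPred_eq, length_lt_mul_simple_iff]
  exact ⟨fun h i hi => h ⟨i, by omega⟩ hi, fun h i hi => h i hi⟩

theorem eq_one_of_inc (hn : 2 ≤ n) {w : W} (h : Inc n (window cs w)) : w = 1 :=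
  eq_one_of_rootVal_pos cs fun i => (inc_iff_rootVal hn _).1 h i i.isLt

theorem inc_one (j : ℕ) : Inc j (window cs 1) := by
  intro a b hab _
  rw [window_one, idWindow, idWindow, Nat.abs_cast]
  exact_mod_cast hab

/-- For j = 1 the condition `Inc` is vacuous, in agreement with x_1 = x_∅. The index 0 is excluded
because of the factor 2 in x_0. -/
theorem coeff_xD (hn : 2 ≤ n) {j : ℕ} (hj : 1 ≤ j) (hjn : j ≤ n) (w : W)
    [Decidable (Inc j (window cs w))] :
    (xD cs j).coeff w = if Inc j (window cs w) then 1 else 0 := by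
  classical
  have := finite_of_typeD cs hn
  have key : ∀ J : Set (Fin n), (descentElt cs J).coeff w =
      if w ∈ distinguishedReps cs J then 1 else 0 := by
    intro J
    rw [descentElt, finsum_mem_eq_finite_toFinset_sum _ (Set.toFinite _), MonoidAlgebra.coeff_sum,
      Finsupp.finsetSum_apply]
    simp [MonoidAlgebra.of_apply, Finsupp.single_apply]
  obtain _ | _ | j := j
  · omega
  · have h1 : Inc 1 (window cs w) := fun a b hab hb => by omega
    rw [if_pos h1]
    exact (key ∅).trans (if_pos fun i hi => absurd hi (Set.notMem_empty i))
  · refine (key _).trans ?_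
    simp only [mem_distinguishedReps_iff cs (Nat.le_add_left 2 j) hjn]

end Window

/-! ### Inserting the last entry: the counting argument -/

/-- Move the entry at position `n - 1` to position `c`. -/
def insertAt (n c : ℕ) (g : ℕ → ℤ) (k : ℕ) : ℤ :=
  if k < c then g k else if k = c then g (n - 1) else if k < n then g (k - 1) else g k

/-- If `ε` holds, negate the entries at the positions `0` and `n - 1`. -/
def negEnds (n : ℕ) (ε : Bool) (g : ℕ → ℤ) (k : ℕ) : ℤ :=
  if ε = true ∧ (k = 0 ∨ k = n - 1) then -g k else g k

theorem insertAt_last {n : ℕ} (hn : 1 ≤ n) (g : ℕ → ℤ) : insertAt n (n - 1) g = g := by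
  funext k
  unfold insertAt
  grind

theorem reflAct_insertAt {n c : ℕ} (hc : c + 1 < n) (g : ℕ → ℤ) :
    reflAct (c + 1) (insertAt n (c + 1) g) = insertAt n c g := by
  funext k
  unfold insertAt reflAct
  grind

theorem insertAt_one_negEnds {n : ℕ} (hn : 3 ≤ n) (g : ℕ → ℤ) :
    insertAt n 1 (negEnds n true g) = reflAct 1 (reflAct 0 (insertAt n 1 g)) := by
  funext k
  unfold insertAt reflAct negEnds
  grind

/-- Among the first j entries only the one at position 0 can change, and only in sign, which `Inc`
ignores. -/
theorem inc_insertAt_of_le {n j c : ℕ} (hj : 2 ≤ j) (hjc : j ≤ c) (hc : c < n) (ε : Bool)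
    (g : ℕ → ℤ) : Inc j (insertAt n c (negEnds n ε g)) ↔ Inc j g := by
  have h0 : ∀ k < j, |insertAt n c (negEnds n ε g) k| = |g k| := by
    intro k hk
    unfold insertAt negEnds
    grind [abs_neg]
  have h1 : ∀ k < j, 0 < k → insertAt n c (negEnds n ε g) k = g k := by
    intro k hk hk0
    unfold insertAt negEnds
    grind
  unfold Inc
  refine forall_congr' fun a => forall_congr' fun b => ?_
  refine forall_congr' fun hab => forall_congr' fun hb => ?_
  rw [h0 a (by omega), h1 b hb (by omega)]

/-- The permutation of the positions underlying `insertAt`. -/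
def insertPos (n c k : ℕ) : ℕ :=
  if k < c then k else if k = c then n - 1 else if k < n then k - 1 else k

theorem abs_insertAt_negEnds (n c : ℕ) (ε : Bool) (g : ℕ → ℤ) (k : ℕ) :
    |insertAt n c (negEnds n ε g) k| = |g (insertPos n c k)| := by
  unfold insertAt negEnds insertPos
  grind [abs_neg]

/-- Separates signs from absolute values, because the insertion merely permutes the latter. -/
theorem inc_iff_abs {j : ℕ} (g : ℕ → ℤ) :
    Inc j g ↔ (∀ b, 0 < b → b < j → 0 < g b) ∧ ∀ a b, a < b → b < j → |g a| < |g b| := by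
  constructor
  · intro h
    have h1 : ∀ b, 0 < b → b < j → 0 < g b :=
      fun b hb hbj => (abs_nonneg _).trans_lt (h 0 b hb hbj)
    refine ⟨h1, fun a b hab hb => ?_⟩
    rw [abs_of_pos (h1 b (by omega) hb)]
    exact h a b hab hb
  · rintro ⟨h1, h2⟩ a b hab hb
    rw [← abs_of_pos (h1 b (by omega) hb)]
    exact h2 a b hab hb

/-- Uniqueness: c is the rank of the last entry by absolute value, and ε is forced by the entry
whose sign matters. For c = 0 that is the old entry 0, pushed to position 1; otherwise it is the
inserted entry. -/
theorem inc_of_inc_insertAt {n j c : ℕ} (hj : 2 ≤ j) (hjn : j ≤ n) (hc : c < j) {ε : Bool}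
    {g : ℕ → ℤ} (h : Inc j (insertAt n c (negEnds n ε g))) :
    Inc (j - 1) g ∧ (∀ i < c, |g i| < |g (n - 1)|) ∧
      (∀ i, c ≤ i → i < j - 1 → |g (n - 1)| < |g i|) ∧
      (ε = true ↔ if c = 0 then g 0 < 0 else g (n - 1) < 0) := by
  rw [inc_iff_abs] at h
  simp only [abs_insertAt_negEnds] at h
  obtain ⟨h1, h2⟩ := h
  refine ⟨?_, ?_, ?_, ?_⟩
  · rw [inc_iff_abs]
    refine ⟨fun b hb hbj => ?_, fun a b hab hb => ?_⟩
    · by_cases hbc : b < c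
      · have := h1 b hb (by omega)
        unfold insertAt negEnds at this
        grind
      · have := h1 (b + 1) (by omega) (by omega)
        unfold insertAt negEnds at this
        grind
    -- These are the positions of the old entries a and b after the insertion.
    · have := h2 (if a < c then a else a + 1) (if b < c then b else b + 1) (by grind) (by grind)
      unfold insertPos at this
      grind
  · intro i hi
    have := h2 i c hi hc
    unfold insertPos at this
    grind
  · intro i hi hij
    have := h2 c (i + 1) (by omega) (by omega)
    unfold insertPos at this
    grind
  · split_ifs with h0
    · have := h1 1 (by omega) (by omega)
      unfold insertAt negEnds at this
      cases ε <;> grind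
    · have := h1 c (by omega) hc
      unfold insertAt negEnds at this
      cases ε <;> grind

theorem exists_inc_insertAt {n j : ℕ} (hj : 2 ≤ j) (hjn : j ≤ n) {g : ℕ → ℤ} (hg : IsWindow n g)
    (h : Inc (j - 1) g) : ∃ c < j, ∃ ε, Inc j (insertAt n c (negEnds n ε g)) := by
  obtain ⟨h1, h2⟩ := (inc_iff_abs g).1 h
  -- The insertion point is the first entry larger than the last one in absolute value, or j - 1 if
  -- there is none.
  have hex : ∃ c, j - 1 ≤ c ∨ |g (n - 1)| < |g c| := ⟨j - 1, Or.inl le_rfl⟩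
  obtain ⟨c, hc, hlt⟩ : ∃ c, (j - 1 ≤ c ∨ |g (n - 1)| < |g c|) ∧
      ∀ i < c, ¬ (j - 1 ≤ i ∨ |g (n - 1)| < |g i|) := by
    classical
    exact ⟨Nat.find hex, Nat.find_spec hex, fun i hi => Nat.find_min hex hi⟩
  have hcj : c < j := by
    by_contra hcon
    exact hlt (j - 1) (by omega) (Or.inl le_rfl)
  have hlow : ∀ i < c, |g i| < |g (n - 1)| := by
    intro i hi
    have h3 := hlt i hi
    have h4 : |g i| ≠ |g (n - 1)| := fun e => by have := hg.abs_inj _ _ e; omega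
    omega
  have hhigh : ∀ i, c ≤ i → i < j - 1 → |g (n - 1)| < |g i| := by
    intro i hi hij
    rcases hc with hc | hc
    · omega
    · rcases hi.eq_or_lt with rfl | hi
      · exact hc
      · exact hc.trans (h2 c i hi hij)
  refine ⟨c, hcj, decide (if c = 0 then g 0 < 0 else g (n - 1) < 0), ?_⟩
  rw [inc_iff_abs]
  simp only [abs_insertAt_negEnds]
  constructor
  · intro b hb hbj
    by_cases h0 : c = 0
    · have h5 : g 0 ≠ 0 := fun e => by
        have := hhigh 0 (by omega) (by omega)
        rw [e, abs_zero] at this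
        exact absurd this (abs_nonneg _).not_gt
      have := h1 (b - 1)
      unfold insertAt negEnds
      grind
    · have h5 : g (n - 1) ≠ 0 := fun e => by
        have := hlow 0 (by omega)
        rw [e, abs_zero] at this
        exact absurd this (abs_nonneg _).not_gt
      have := h1 (b - 1)
      have := h1 b
      unfold insertAt negEnds
      grind
  · intro a b hab hb
    unfold insertPos
    have := hlow a
    have := hhigh (b - 1)
    have := h2 a b
    have := h2 a (b - 1)
    have := h2 (a - 1) (b - 1)
    grind

theorem sum_inc_insertAt {n j : ℕ} (hj : 2 ≤ j) (hjn : j ≤ n) {g : ℕ → ℤ} (hg : IsWindow n g)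
    [DecidablePred fun g : ℕ → ℤ => Inc j g] [Decidable (Inc (j - 1) g)] :
    ∑ p ∈ Finset.range n ×ˢ (Finset.univ : Finset Bool),
        (if Inc j (insertAt n p.1 (negEnds n p.2 g)) then (1 : ℚ) else 0) =
      2 * (n - j) * (if Inc j g then 1 else 0) + (if Inc (j - 1) g then 1 else 0) := by
  rw [Finset.sum_product, ← Finset.sum_range_add_sum_Ico _ hjn, add_comm]
  congr 1
  · have : ∀ c ∈ Finset.Ico j n, (∑ ε : Bool,
        if Inc j (insertAt n c (negEnds n ε g)) then (1 : ℚ) else 0) =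
          2 * (if Inc j g then 1 else 0) := by
      intro c hc
      rw [Finset.mem_Ico] at hc
      simp only [inc_insertAt_of_le hj hc.1 hc.2]
      simp
    rw [Finset.sum_congr rfl this, Finset.sum_const, Nat.card_Ico, nsmul_eq_mul, Nat.cast_sub hjn]
    ring
  · rw [← Finset.sum_product']
    split_ifs with h
    · obtain ⟨c, hc, ε, hinc⟩ := exists_inc_insertAt hj hjn hg h
      rw [Finset.sum_eq_single (c, ε), if_pos hinc]
      · rintro ⟨c', ε'⟩ hmem hne
        rw [if_neg]
        intro hinc'
        simp only [Finset.mem_product, Finset.mem_range, Finset.mem_univ, and_true] at hmem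
        obtain ⟨-, h1, h2, h3⟩ := inc_of_inc_insertAt hj hjn hc hinc
        obtain ⟨-, h1', h2', h3'⟩ := inc_of_inc_insertAt hj hjn hmem hinc'
        have hcc : c' = c := by
          rcases lt_trichotomy c' c with hlt | heq | hlt
          · exact absurd (h1 c' hlt) (h2' c' le_rfl (by omega)).not_gt
          · exact heq
          · exact absurd (h1' c hlt) (h2 c le_rfl (by omega)).not_gt
        subst hcc
        exact hne (Prod.ext rfl (Bool.eq_iff_iff.2 (h3'.trans h3.symm)))
      · intro hmem
        exact absurd (Finset.mem_product.2 ⟨Finset.mem_range.2 hc, Finset.mem_univ _⟩) hmem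
    · refine Finset.sum_eq_zero fun p hp => if_neg fun hinc => h ?_
      rw [Finset.mem_product, Finset.mem_range] at hp
      exact (inc_of_inc_insertAt hj hjn hp.1 hinc).1

/-! ### The multiplication rule for x_{n-1} -/

section Recurrence

variable {n : ℕ} {W : Type*} [Group W] (cs : CoxeterSystem (typeD n) W)

theorem exists_windowAct_insertAt (c : ℕ) (hc : c < n) :
    ∃ e : W, ∀ g, windowAct cs e g = insertAt n c g := by
  obtain ⟨d, hd⟩ : ∃ d, c + d + 1 = n := ⟨n - 1 - c, by omega⟩
  induction d generalizing c with
  | zero =>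
    refine ⟨1, fun g => ?_⟩
    rw [windowAct_one, show c = n - 1 by omega, insertAt_last (by omega)]
  | succ d ih =>
    obtain ⟨e, he⟩ := ih (c + 1) (by omega) (by omega)
    refine ⟨cs.simple ⟨c + 1, by omega⟩ * e, fun g => ?_⟩
    rw [windowAct_mul, he, windowAct_simple]
    exact reflAct_insertAt (by omega) g

theorem exists_windowAct_negEnds (hn : 3 ≤ n) (ε : Bool) :
    ∃ e : W, ∀ g, windowAct cs e g = negEnds n ε g := by
  cases ε with
  | false =>
    refine ⟨1, fun g => ?_⟩
    rw [windowAct_one]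
    funext k
    simp [negEnds]
  | true =>
    obtain ⟨e, he⟩ := exists_windowAct_insertAt cs 1 (by omega)
    -- s_1 s_0 on indices negates positions 0 and 1; conjugating by the move of the last entry to
    -- position 1 carries this to the two ends.
    refine ⟨e⁻¹ * (cs.simple ⟨1, by omega⟩ * cs.simple ⟨0, by omega⟩ * e), fun g => ?_⟩
    rw [windowAct_mul, windowAct_mul, windowAct_mul, he, windowAct_simple, windowAct_simple,
      ← insertAt_one_negEnds hn, ← he, ← windowAct_mul, inv_mul_cancel, windowAct_one]

theorem xD_mul_xD_pred (hn : 3 ≤ n) {j : ℕ} (hj : 1 ≤ j) (hjn : j ≤ n) :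
    xD cs j * xD cs (n - 1) = (2 * ((n : ℚ) - j)) • xD cs j + xD cs (j - 1) := by
  classical
  have hex : ∀ p : ℕ × Bool, ∃ e : W, p.1 < n →
      ∀ g, windowAct cs e g = insertAt n p.1 (negEnds n p.2 g) := by
    rintro ⟨c, ε⟩
    by_cases hc : c < n
    · obtain ⟨e, he⟩ := exists_windowAct_insertAt cs c hc
      obtain ⟨t, ht⟩ := exists_windowAct_negEnds cs hn ε
      exact ⟨e * t, fun _ g => by rw [windowAct_mul, ht, he]⟩
    · exact ⟨1, fun h => absurd h hc⟩
  choose e he using hex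
  have hw : ∀ w : W, ∀ p ∈ Finset.range n ×ˢ (Finset.univ : Finset Bool),
      window cs (w * (e p)⁻¹) = insertAt n p.1 (negEnds n p.2 (window cs w)) := by
    intro w p hp
    rw [Finset.mem_product, Finset.mem_range] at hp
    rw [window_mul, inv_inv, he p hp.1]
  have hx : xD cs (n - 1) = ∑ p ∈ Finset.range n ×ˢ (Finset.univ : Finset Bool),
      MonoidAlgebra.single (e p) (1 : ℚ) := by
    ext w
    rw [coeff_xD cs (by omega) (by omega) (by omega), MonoidAlgebra.coeff_sum,
      Finsupp.finsetSum_apply]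
    -- For j = n the multiple 2(n - j) vanishes and `Inc n` holds only at the identity, so the count
    -- detects the summands of x_{n-1}.
    have h1 := sum_inc_insertAt (j := n) (by omega) le_rfl (isWindow_window cs (by omega) w)
    rw [sub_self, mul_zero, zero_mul, zero_add] at h1
    rw [← h1]
    refine Finset.sum_congr rfl fun p hp => ?_
    rw [← hw w p hp, MonoidAlgebra.coeff_single, Finsupp.single_apply]
    refine if_congr ⟨fun h => ?_, fun h => ?_⟩ rfl rfl
    · exact (mul_inv_eq_one.1 (eq_one_of_inc cs (by omega) h)).symm
    · rw [← h, mul_inv_cancel]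
      exact inc_one cs n
  have hcoeff : ∀ w, (xD cs j * xD cs (n - 1)).coeff w =
      ∑ p ∈ Finset.range n ×ˢ (Finset.univ : Finset Bool),
        (if Inc j (insertAt n p.1 (negEnds n p.2 (window cs w))) then (1 : ℚ) else 0) := by
    intro w
    rw [hx, Finset.mul_sum, MonoidAlgebra.coeff_sum, Finsupp.finsetSum_apply]
    refine Finset.sum_congr rfl fun p hp => ?_
    rw [MonoidAlgebra.coeff_mul_single_apply, mul_one, coeff_xD cs (by omega) hj hjn, hw w p hp]
  ext w
  rw [hcoeff, MonoidAlgebra.coeff_add, Finsupp.add_apply, MonoidAlgebra.coeff_smul_apply,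
    smul_eq_mul, coeff_xD cs (by omega) hj hjn]
  -- For j = 1 all 2n pairs count, and 2n = 2(n - 1) + 2 accounts for x_0 = 2x_1.
  rcases hj.eq_or_lt with rfl | hj
  · have h1 : ∀ g, Inc 1 g := fun g a b hab hb => by omega
    have h0 : (xD cs (1 - 1)).coeff w = 2 := by
      rw [Nat.sub_self]
      change (2 * xD cs 1).coeff w = 2
      rw [two_mul, MonoidAlgebra.coeff_add, Finsupp.add_apply, coeff_xD cs (by omega) le_rfl hjn,
        if_pos (h1 _)]
      norm_num
    rw [h0]
    simp only [h1, if_true, Finset.sum_const, Finset.card_product, Finset.card_range]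
    simp
    ring
  · rw [sum_inc_insertAt hj hjn (isWindow_window cs (by omega) w),
      coeff_xD cs (by omega) (by omega) (by omega)]

end Recurrence

/-! ### Even falling factorials, Stirling numbers and the quotient algebra -/

section EvenFactorial

variable {A : Type*} [Ring A]

/-- The product `x (x - 2) (x - 4) ⋯ (x - 2 (k - 1))`. -/
def evenFallingFactorial (x : A) (k : ℕ) : A :=
  ((List.range k).map fun i : ℕ => x - 2 * (i : A)).prod

theorem evenFallingFactorial_zero (x : A) : evenFallingFactorial x 0 = 1 := rfl

theorem map_evenFallingFactorial {B F : Type*} [Ring B] [FunLike F A B] [RingHomClass F A B]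
    (f : F) (x : A) (k : ℕ) :
    f (evenFallingFactorial x k) = evenFallingFactorial (f x) k := by
  have h2 : f 2 = 2 := map_ofNat f 2
  simp [evenFallingFactorial, map_list_prod, Function.comp_def, h2]

variable [Algebra ℚ A]

theorem evenFallingFactorial_mul (x : A) (k : ℕ) :
    evenFallingFactorial x k * x =
      (2 * (k : ℚ)) • evenFallingFactorial x k + evenFallingFactorial x (k + 1) := by
  have e : (2 * (k : ℚ)) • evenFallingFactorial x k = evenFallingFactorial x k * (2 * (k : A)) := by
    rw [Algebra.smul_def, Algebra.commutes, map_mul, map_natCast, map_ofNat]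
  rw [e]
  simp [evenFallingFactorial, List.range_succ, mul_sub]

theorem evenFallingFactorial_eq_sum (x : A) (k : ℕ) :
    evenFallingFactorial x k = ∑ m ∈ Finset.range (k + 1),
      ((-2 : ℚ) ^ (k - m) * (Nat.stirlingFirst k m : ℚ)) • x ^ m := by
  induction k with
  | zero => simp [evenFallingFactorial_zero]
  | succ k ih =>
    have e : evenFallingFactorial x (k + 1) =
        evenFallingFactorial x k * x - (2 * (k : ℚ)) • evenFallingFactorial x k := by
      rw [evenFallingFactorial_mul]
      abel
    have e1 : (2 * (k : ℚ)) • evenFallingFactorial x k = -∑ m ∈ Finset.range (k + 1),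
        ((-2 : ℚ) ^ (k - m) * ((k : ℚ) * (Nat.stirlingFirst k (m + 1) : ℚ))) • x ^ (m + 1) := by
      rw [Finset.sum_range_succ, Nat.stirlingFirst_eq_zero_of_lt (Nat.lt_succ_self k), ih,
        Finset.sum_range_succ', smul_add, Finset.smul_sum, smul_smul]
      -- Both boundary terms of the index shift vanish; here k = 0 or [k, 0] = 0.
      have h0 : 2 * (k : ℚ) * ((-2 : ℚ) ^ (k - 0) * (Nat.stirlingFirst k 0 : ℚ)) = 0 := by
        cases k <;> simp
      rw [h0, Nat.cast_zero, mul_zero, mul_zero, zero_smul, zero_smul, add_zero, add_zero,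
        ← Finset.sum_neg_distrib]
      refine Finset.sum_congr rfl fun m hm => ?_
      rw [Finset.mem_range] at hm
      rw [smul_smul, ← neg_smul, show k - m = k - (m + 1) + 1 by omega, pow_succ]
      congr 1
      ring
    rw [e, e1, ih, Finset.sum_mul, sub_neg_eq_add, ← Finset.sum_add_distrib,
      Finset.sum_range_succ' _ (k + 1)]
    simp only [Nat.stirlingFirst_succ_zero, Nat.cast_zero, mul_zero, zero_smul, add_zero]
    refine Finset.sum_congr rfl fun m _ => ?_
    rw [smul_mul_assoc, ← pow_succ, ← add_smul, Nat.stirlingFirst_succ_succ, Nat.add_sub_add_right]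
    congr 1
    push_cast
    ring

theorem pow_eq_sum_evenFallingFactorial (x : A) (k : ℕ) :
    x ^ k = ∑ m ∈ Finset.range (k + 1),
      ((Nat.stirlingSecond k m : ℚ) * 2 ^ (k - m)) • evenFallingFactorial x m := by
  induction k with
  | zero => simp [evenFallingFactorial_zero]
  | succ k ih =>
    rw [pow_succ, ih, Finset.sum_mul]
    have e : ∀ m ∈ Finset.range (k + 1),
        ((Nat.stirlingSecond k m : ℚ) * 2 ^ (k - m)) • evenFallingFactorial x m * x =
        ((m * Nat.stirlingSecond k m : ℚ) * 2 ^ (k + 1 - m)) • evenFallingFactorial x m +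
        ((Nat.stirlingSecond k m : ℚ) * 2 ^ (k + 1 - (m + 1))) •
          evenFallingFactorial x (m + 1) := by
      intro m hm
      rw [Finset.mem_range] at hm
      rw [smul_mul_assoc, evenFallingFactorial_mul, smul_add, smul_smul, Nat.add_sub_add_right,
        Nat.succ_sub (by omega : m ≤ k), pow_succ]
      congr 2
      ring
    rw [Finset.sum_congr rfl e, Finset.sum_add_distrib, Finset.sum_range_succ' _ (k + 1)]
    have e2 : ∑ m ∈ Finset.range (k + 1),
        ((m * Nat.stirlingSecond k m : ℚ) * 2 ^ (k + 1 - m)) • evenFallingFactorial x m =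
        ∑ m ∈ Finset.range (k + 1), (((m + 1 : ℕ) * Nat.stirlingSecond k (m + 1) : ℚ) *
          2 ^ (k + 1 - (m + 1))) • evenFallingFactorial x (m + 1) := by
      have := Finset.sum_range_succ' (fun m =>
        ((m * Nat.stirlingSecond k m : ℚ) * 2 ^ (k + 1 - m)) • evenFallingFactorial x m) (k + 1)
      rw [Finset.sum_range_succ, Nat.stirlingSecond_eq_zero_of_lt (Nat.lt_succ_self k)] at this
      simpa using this
    rw [e2, ← Finset.sum_add_distrib]
    simp only [Nat.stirlingSecond_succ_zero, Nat.cast_zero, zero_mul, zero_smul, add_zero]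
    refine Finset.sum_congr rfl fun m _ => ?_
    rw [← add_smul, ← add_mul, Nat.stirlingSecond_succ_succ]
    push_cast
    rfl

theorem pow_smul_aeval_descPochhammer (x : A) (k : ℕ) :
    (2 ^ k : ℚ) • aeval ((1 / 2 : ℚ) • x) (descPochhammer ℚ k) = evenFallingFactorial x k := by
  induction k with
  | zero => simp [evenFallingFactorial_zero]
  | succ k ih =>
    have e : evenFallingFactorial x (k + 1) =
        evenFallingFactorial x k * x - (2 * (k : ℚ)) • evenFallingFactorial x k := by
      rw [evenFallingFactorial_mul]
      abel
    rw [e, ← ih, descPochhammer_succ_right, map_mul, map_sub, aeval_X, map_natCast, mul_sub,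
      mul_smul_comm, smul_sub, smul_smul, smul_smul, smul_mul_assoc]
    congr 1
    · rw [pow_succ]
      congr 1
      ring
    · rw [← map_natCast (algebraMap ℚ A), ← Algebra.commutes, ← Algebra.smul_def, smul_smul]
      congr 1
      ring

theorem natDegree_descPochhammer_sub {n : ℕ} (hn : 1 ≤ n) :
    (descPochhammer ℚ n - descPochhammer ℚ (n - 1)).natDegree = n := by
  rw [natDegree_sub_eq_left_of_natDegree_lt, descPochhammer_natDegree]
  rw [descPochhammer_natDegree, descPochhammer_natDegree]
  omega

variable {n : ℕ} {x : A}

/-- The span is stable under multiplication by x; the relation is needed only at the top index k = n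
- 1. -/
theorem span_evenFallingFactorial (hn : 1 ≤ n) (hx : Algebra.adjoin ℚ {x} = ⊤)
    (hrel : evenFallingFactorial x n = 2 * evenFallingFactorial x (n - 1)) :
    Submodule.span ℚ (Set.range fun i : Fin n => evenFallingFactorial x i) = ⊤ := by
  set V := Submodule.span ℚ (Set.range fun i : Fin n => evenFallingFactorial x i) with hV
  have hmem : ∀ k < n, evenFallingFactorial x k ∈ V :=
    fun k hk => Submodule.subset_span ⟨⟨k, hk⟩, rfl⟩
  have hmul : ∀ v ∈ V, v * x ∈ V := by
    intro v hv
    induction hv using Submodule.span_induction with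
    | zero => simp
    | add u v _ _ hu hv => rw [add_mul]; exact V.add_mem hu hv
    | smul c v _ hv => rw [smul_mul_assoc]; exact V.smul_mem c hv
    | mem v hv =>
      obtain ⟨⟨k, hk⟩, rfl⟩ := hv
      change evenFallingFactorial x k * x ∈ V
      rw [evenFallingFactorial_mul]
      refine V.add_mem (V.smul_mem _ (hmem k hk)) ?_
      rcases (Nat.succ_le_of_lt hk).eq_or_lt with h | h
      · rw [← Nat.succ_eq_add_one, h, hrel, two_mul]
        exact V.add_mem (hmem _ (by omega)) (hmem _ (by omega))
      · exact hmem _ h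
  have hpow : ∀ k, x ^ k ∈ V := by
    intro k
    induction k with
    | zero => rw [pow_zero]; exact hmem 0 hn
    | succ k ih => rw [pow_succ]; exact hmul _ ih
  rw [eq_top_iff]
  intro v _
  have hv : v ∈ Algebra.adjoin ℚ {x} := hx ▸ Algebra.mem_top
  rw [Algebra.adjoin_singleton_eq_range_aeval] at hv
  obtain ⟨p, rfl⟩ := hv
  change aeval x p ∈ V
  rw [aeval_eq_sum_range]
  exact V.sum_mem fun k _ => V.smul_mem _ (hpow k)

theorem exists_basis_evenFallingFactorial (hn : 1 ≤ n) (hx : Algebra.adjoin ℚ {x} = ⊤)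
    (hrel : evenFallingFactorial x n = 2 * evenFallingFactorial x (n - 1))
    (hli : LinearIndependent ℚ fun i : Fin n => evenFallingFactorial x i) :
    ∃ b : Module.Basis (Fin n) ℚ A, ∀ i : Fin n, b i = evenFallingFactorial x i :=
  ⟨Module.Basis.mk hli (span_evenFallingFactorial hn hx hrel).ge,
    fun i => Module.Basis.mk_apply _ _ i⟩

theorem exists_basis_pow
    (b : Module.Basis (Fin n) ℚ A) (hb : ∀ i : Fin n, b i = evenFallingFactorial x i) :
    ∃ b : Module.Basis (Fin n) ℚ A, ∀ i : Fin n, b i = x ^ (i : ℕ) := by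
  have hspan : ⊤ ≤ Submodule.span ℚ (Set.range fun i : Fin n => x ^ (i : ℕ)) := by
    rw [← b.span_eq, Submodule.span_le]
    rintro _ ⟨i, rfl⟩
    rw [hb, evenFallingFactorial_eq_sum]
    refine Submodule.sum_mem _ fun m hm => Submodule.smul_mem _ _ (Submodule.subset_span ?_)
    rw [Finset.mem_range] at hm
    exact ⟨⟨m, by omega⟩, rfl⟩
  exact ⟨basisOfTopLeSpanOfCardEqFinrank _ hspan (Module.finrank_eq_card_basis b).symm,
    fun i => by rw [coe_basisOfTopLeSpanOfCardEqFinrank]⟩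

/-- X ↦ x/2 gives a surjection between spaces of dimension n. The factor 2 in the relation is
absorbed by the rescaling 2^n = 2 · 2^{n-1}. -/
theorem exists_algEquiv_quotient (hn : 1 ≤ n) (hx : Algebra.adjoin ℚ {x} = ⊤)
    (hrel : evenFallingFactorial x n = 2 * evenFallingFactorial x (n - 1))
    (b : Module.Basis (Fin n) ℚ A) :
    ∃ φ : A ≃ₐ[ℚ] ℚ[X] ⧸ Ideal.span {descPochhammer ℚ n - descPochhammer ℚ (n - 1)},
      φ x = Ideal.Quotient.mk _ (2 * X) := by
  set p := descPochhammer ℚ n - descPochhammer ℚ (n - 1) with hp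
  have hroot : aeval ((1 / 2 : ℚ) • x) p = 0 := by
    have h1 := pow_smul_aeval_descPochhammer x n
    obtain ⟨m, rfl⟩ : ∃ m, n = m + 1 := ⟨n - 1, by omega⟩
    rw [Nat.add_sub_cancel] at *
    rw [hrel, ← pow_smul_aeval_descPochhammer, ← map_ofNat (algebraMap ℚ A) 2,
      ← Algebra.smul_def, smul_smul, ← pow_succ'] at h1
    rw [hp, map_sub, sub_eq_zero]
    exact smul_right_injective A (pow_ne_zero (m + 1) (two_ne_zero : (2 : ℚ) ≠ 0)) h1
  have hker : ∀ q ∈ Ideal.span {p}, aeval ((1 / 2 : ℚ) • x) q = 0 := by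
    intro q hq
    obtain ⟨r, rfl⟩ := Ideal.mem_span_singleton.1 hq
    rw [map_mul, hroot, zero_mul]
  let f : (ℚ[X] ⧸ Ideal.span {p}) →ₐ[ℚ] A := Ideal.Quotient.liftₐ _ _ hker
  have hfx : f (Ideal.Quotient.mk _ (2 * X)) = x := by
    change aeval ((1 / 2 : ℚ) • x) (2 * X) = x
    rw [map_mul, aeval_X, map_ofNat, ← map_ofNat (algebraMap ℚ A) 2, ← Algebra.smul_def,
      smul_smul]
    norm_num
  have hsurj : Function.Surjective f := by
    rw [← AlgHom.range_eq_top, ← top_le_iff, ← hx, Algebra.adjoin_le_iff,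
      Set.singleton_subset_iff]
    exact ⟨_, hfx⟩
  have hdeg : Module.finrank ℚ (ℚ[X] ⧸ Ideal.span {p}) = n := by
    rw [finrank_quotient_span_eq_natDegree, natDegree_descPochhammer_sub hn]
  have hA : Module.finrank ℚ A = n := by
    rw [Module.finrank_eq_card_basis b, Fintype.card_fin]
  have : FiniteDimensional ℚ A := b.finiteDimensional_of_finite
  have : FiniteDimensional ℚ (ℚ[X] ⧸ Ideal.span {p}) :=
    Module.finite_of_finrank_pos (by omega)
  have hinj : Function.Injective f :=
    (LinearMap.injective_iff_surjective_of_finrank_eq_finrank (f := f.toLinearMap)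
      (hdeg.trans hA.symm)).2 hsurj
  refine ⟨(AlgEquiv.ofBijective f ⟨hinj, hsurj⟩).symm, ?_⟩
  rw [AlgEquiv.symm_apply_eq]
  exact hfx.symm

end EvenFactorial

/-! ### The elements x_j inside 𝔈(W) -/

section Bases

variable {n : ℕ} {W : Type*} [Group W] (cs : CoxeterSystem (typeD n) W)

theorem xD_self (hn : 2 ≤ n) : xD cs n = 1 := by
  classical
  ext w
  rw [coeff_xD cs hn (by omega) le_rfl, MonoidAlgebra.one_def, MonoidAlgebra.coeff_single,
    Finsupp.single_apply]
  refine if_congr ⟨fun h => (eq_one_of_inc cs hn h).symm, ?_⟩ rfl rfl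
  rintro rfl
  exact inc_one cs n

theorem xD_sub_eq (hn : 3 ≤ n) (k : ℕ) (hk : k ≤ n) :
    xD cs (n - k) = evenFallingFactorial (xD cs (n - 1)) k := by
  induction k with
  | zero => rw [Nat.sub_zero, xD_self cs (by omega), evenFallingFactorial_zero]
  | succ k ih =>
    have h := xD_mul_xD_pred cs hn (j := n - k) (by omega) (by omega)
    rw [ih (by omega), evenFallingFactorial_mul, Nat.cast_sub (by omega), sub_sub_cancel] at h
    rw [Nat.sub_succ']
    exact (add_left_cancel h).symm

theorem inc_window_simple_iff {m : Fin n} (hm : 1 ≤ (m : ℕ)) (j : ℕ) :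
    Inc j (window cs (cs.simple m)) ↔ j ≤ m := by
  have hw : window cs (cs.simple m) = reflAct m idWindow := by
    rw [← one_mul (cs.simple m), window_mul_simple, window_one]
  rw [hw]
  constructor
  · intro h
    by_contra hcon
    have := h (m - 1) m (by omega) (by omega)
    have h2 := (le_abs_self _).trans_lt this
    unfold reflAct idWindow at h2
    grind
  · intro h a b hab hb
    unfold reflAct idWindow
    grind

/-- The coefficients at the simple reflections s with index m ≥ 1, and at 1, give all partial sums
of a relation; their differences are its coefficients. -/
theorem linearIndependent_xD (hn : 2 ≤ n) :
    LinearIndependent ℚ fun i : Fin n => xD cs ((i : ℕ) + 1) := by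
  classical
  rw [Fintype.linearIndependent_iff]
  intro a ha
  have hsum : ∀ w : W,
      ∑ i : Fin n, a i * (if Inc ((i : ℕ) + 1) (window cs w) then 1 else 0) = 0 := by
    intro w
    have := congrArg (fun z : MonoidAlgebra ℚ W => z.coeff w) ha
    simp only [MonoidAlgebra.coeff_sum, Finsupp.finsetSum_apply, MonoidAlgebra.coeff_smul_apply,
      smul_eq_mul, MonoidAlgebra.coeff_zero, Finsupp.zero_apply] at this
    refine Eq.trans ?_ this
    exact Finset.sum_congr rfl fun i _ => by rw [coeff_xD cs hn (by omega) i.isLt]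
  have hpart : ∀ m ≤ n, ∑ i : Fin n, a i * (if (i : ℕ) < m then 1 else 0) = 0 := by
    intro m hm
    rcases hm.eq_or_lt with rfl | hm
    · refine Eq.trans ?_ (hsum 1)
      exact Finset.sum_congr rfl fun i _ => by rw [if_pos i.isLt, if_pos (inc_one cs _)]
    · rcases Nat.eq_zero_or_pos m with rfl | hm0
      · simp
      · refine Eq.trans ?_ (hsum (cs.simple ⟨m, hm⟩))
        simp only [inc_window_simple_iff cs (m := ⟨m, hm⟩) hm0, Nat.succ_le_iff]
  intro i
  have h1 := hpart (i + 1) i.isLt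
  have h2 := hpart i i.isLt.le
  rw [← sub_eq_zero.2 (h1.trans h2.symm), ← Finset.sum_sub_distrib, Finset.sum_eq_single i]
  · simp
  · intro j _ hj
    have : (j : ℕ) < i + 1 ↔ (j : ℕ) < i := by
      have := Fin.val_ne_of_ne hj
      omega
    simp [this]
  · simp

theorem adjoin_algEGen : Algebra.adjoin ℚ {algEGen cs} = ⊤ := by
  have h := Algebra.adjoin_adjoin_coe_preimage (R := ℚ) (s := {xD cs (n - 1)})
  have e : ((↑) : algE cs → MonoidAlgebra ℚ W) ⁻¹' {xD cs (n - 1)} = {algEGen cs} := by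
    ext y
    rw [Set.mem_preimage, Set.mem_singleton_iff, Set.mem_singleton_iff, Subtype.ext_iff]
    rfl
  exact e ▸ h

end Bases

/-! ### Assembly of the main theorem -/

theorem mainTheorem6 (n : ℕ) (hn : 3 ≤ n) {W : Type*} [Group W]
    (cs : CoxeterSystem (typeD n) W) :
    Finite W ∧
    (∃ φ : algE cs ≃ₐ[ℚ]
        ℚ[X] ⧸ Ideal.span {descPochhammer ℚ n - descPochhammer ℚ (n - 1)},
      φ (algEGen cs) = Ideal.Quotient.mk _ (2 * X)) ∧
    (∃ b : Module.Basis (Fin n) ℚ (algE cs),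
      ∀ i : Fin n, (b i : MonoidAlgebra ℚ W) = xD cs ((i : ℕ) + 1)) ∧
    (∃ b : Module.Basis (Fin n) ℚ (algE cs),
      ∀ i : Fin n, (b i : MonoidAlgebra ℚ W) = xD cs (n - 1) ^ (i : ℕ)) ∧
    (∀ k : ℕ, k ≤ n - 1 →
      xD cs (n - k) =
        ((List.range k).map fun i : ℕ => xD cs (n - 1) - 2 * (i : MonoidAlgebra ℚ W)).prod ∧
      xD cs (n - k) =
        ∑ m ∈ Finset.range (k + 1),
          ((-2 : ℚ) ^ (k - m) * (Nat.stirlingFirst k m : ℚ)) • xD cs (n - 1) ^ m ∧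
      xD cs (n - 1) ^ k =
        ∑ m ∈ Finset.range (k + 1),
          ((Nat.stirlingSecond k m : ℚ) * 2 ^ (k - m)) • xD cs (n - m)) := by
  have hcoe : ∀ k ≤ n, ((evenFallingFactorial (algEGen cs) k : algE cs) : MonoidAlgebra ℚ W) =
      xD cs (n - k) := fun k hk =>
    (map_evenFallingFactorial (algE cs).val (algEGen cs) k).trans (xD_sub_eq cs hn k hk).symm
  have hrel : evenFallingFactorial (algEGen cs) n =
      2 * evenFallingFactorial (algEGen cs) (n - 1) := by
    apply Subtype.ext
    change _ = 2 * ((evenFallingFactorial (algEGen cs) (n - 1) : algE cs) : MonoidAlgebra ℚ W)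
    rw [hcoe n le_rfl, hcoe (n - 1) (by omega), Nat.sub_self, Nat.sub_sub_self (by omega)]
    rfl
  have hli : LinearIndependent ℚ fun i : Fin n => evenFallingFactorial (algEGen cs) (i : ℕ) := by
    apply LinearIndependent.of_comp (algE cs).val.toLinearMap
    -- The reversal of `Fin n` matches the k-th product with x_{n-k}.
    have h := (linearIndependent_xD cs (by omega)).comp _ Fin.rev_injective
    have e : ((algE cs).val.toLinearMap ∘ fun i : Fin n =>
        evenFallingFactorial (algEGen cs) (i : ℕ)) =
        (fun i : Fin n => xD cs ((i : ℕ) + 1)) ∘ Fin.rev := by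
      funext i
      refine (hcoe i i.isLt.le).trans ?_
      simp only [Function.comp_apply, Fin.val_rev]
      congr 1
      omega
    rw [e]
    exact h
  obtain ⟨b, hb⟩ := exists_basis_evenFallingFactorial (by omega) (adjoin_algEGen cs) hrel hli
  refine ⟨finite_of_typeD cs (by omega),
    exists_algEquiv_quotient (by omega) (adjoin_algEGen cs) hrel b,
    ⟨b.reindex Fin.revPerm, fun i => ?_⟩, ?_, fun k hk => ⟨?_, ?_, ?_⟩⟩
  · rw [Module.Basis.reindex_apply, hb, hcoe _ (Fin.isLt _).le]
    simp only [Fin.revPerm_symm, Fin.revPerm_apply, Fin.val_rev]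
    congr 1
    omega
  · obtain ⟨c, hc⟩ := exists_basis_pow b hb
    exact ⟨c, fun i => by rw [hc]; rfl⟩
  · exact xD_sub_eq cs hn k (by omega)
  · rw [xD_sub_eq cs hn k (by omega), evenFallingFactorial_eq_sum]
  · rw [pow_eq_sum_evenFallingFactorial]
    refine Finset.sum_congr rfl fun m hm => ?_
    rw [Finset.mem_range] at hm
    rw [xD_sub_eq cs hn m (by omega)]

end
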